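/- For integers $k\ge1$, $n\ge0$, let $p_{-k}(n)$ be the number of $k$-colored partitions of $n$, i.e. partitions of $n$ in which each part carries one of $k$ colors (multisets of pairs (positive part, color) whose parts sum to $n$). For $j\ge1$ let $E_j=(q^j;q^j)_\infty=\prod_{n\ge1}(1-q^{jn})$, a formal power series in $\mathbb Z[[q]]$ with constant term $1$. Define integers $m(i,j)$, $i,j\ge1$, as follows. The first five rows are $$\begin{pmatrix}5&0&0&0&0&0&\cdots\\ 2\cdot5&5^3&0&0&0&0&\cdots\\ 9&3\cdot5^3&5^5&0&0&0&\cdots\\ 4&22\cdot5^2&4\cdot5^5&5^7&0&0&\cdots\\ 1&4\cdot5^3&8\cdot5^5&5^8&5^9&0&\cdots\end{pmatrix},$$ and for $i\ge6$, $m(i,1)=0$ and, for $j\ge2$, $$m(i,j)=25m(i-1,j-1)+25m(i-2,j-1)+15m(i-3,j-1)+5m(i-4,j-1)+m(i-5,j-1).$$ Define integers $b(j,k)$, $j,k\ge1$, by $b(1,1)=315$, $b(1,2)=52\cdot5^4$, $b(1,3)=63\cdot5^6$, $b(1,4)=6\cdot5^9$, $b(1,5)=5^{11}$, $b(1,k)=0$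 for $k\ge6$, and $$b(j+1,k)=\sum_{i=1}^{\infty}b(j,i)\,m(6i+6,k+i+1)\qquad(j\ge1,\ k\ge1),$$ where the sum has only finitely many nonzero terms. Theorem. For every integer $j\ge1$, in $\mathbb Z[[q]]$, $$\sum_{n=0}^{\infty}p_{-6}\!\left(5^{j}n+\frac{3\cdot5^{j}+1}{4}\right)q^{n}=\sum_{l=1}^{\infty}b(j,l)\,q^{l-1}\,\frac{E_5^{6l}}{E_1^{6l+6}}.$$ -/

import Mathlib

open scoped PowerSeries.WithPiTopology

namespace ColoredPartitions

/-- A `k`-colored partition of `n`: a multiset of pairs (part, color), where the parts are positive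
integers with sum `n` and there are `k` available colors. -/
@[ext]
structure ColoredPartition (k n : ℕ) where
  /-- The parts with their colors. -/
  parts : Multiset (ℕ × Fin k)
  parts_pos : ∀ x ∈ parts, 0 < x.1
  parts_sum : (parts.map Prod.fst).sum = n

/-- There are only finitely many `k`-colored partitions of `n`. -/
instance (k n : ℕ) : Finite (ColoredPartition k n) := by
  classical
  have hfin : (Set.Iic (n • (Finset.range (n + 1) ×ˢ (Finset.univ : Finset (Fin k))).val)).Finite :=
    Set.finite_Iic _
  have := hfin.to_subtype
  refine Finite.of_injective (β := Set.Iic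
    (n • (Finset.range (n + 1) ×ˢ (Finset.univ : Finset (Fin k))).val))
    (fun c => ⟨c.parts, ?_⟩) ?_
  · rw [Set.mem_Iic, Multiset.le_iff_count]
    intro x
    by_cases hx : x ∈ c.parts
    · have h1 : x.1 ≤ n := by
        rw [← c.parts_sum]
        exact Multiset.single_le_sum (fun _ _ => Nat.zero_le _) _ (Multiset.mem_map_of_mem _ hx)
      have h2 : c.parts.card ≤ n := by
        have h := Multiset.card_nsmul_le_sum (s := c.parts.map Prod.fst) (a := 1) (by
          intro y hy
          obtain ⟨z, hz, rfl⟩ := Multiset.mem_map.1 hy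
          exact c.parts_pos z hz)
        simpa [c.parts_sum] using h
      have h3 : Multiset.count x (Finset.range (n + 1) ×ˢ (Finset.univ : Finset (Fin k))).val = 1 :=
        Multiset.count_eq_one_of_mem (Finset.nodup _) (by
          rw [Finset.mem_val, Finset.mem_product]
          exact ⟨Finset.mem_range.2 (by omega), Finset.mem_univ _⟩)
      rw [Multiset.count_nsmul, h3, mul_one]
      exact (Multiset.count_le_card _ _).trans h2
    · simp [Multiset.count_eq_zero_of_notMem hx]
  · intro c d h
    exact ColoredPartition.ext (congrArg Subtype.val h)

/-- The number `p_{-k}(n)` of `k`-colored partitions of `n`. -/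
noncomputable def numColored (k n : ℕ) : ℕ := Nat.card (ColoredPartition k n)

/-- The formal power series `E_j = (q^j; q^j)_∞ = ∏_{n ≥ 0} (1 - q^{j (n + 1)})`, for `j ≥ 1`,
as a convergent infinite product in `ℤ⟦q⟧`. -/
noncomputable def E (j : ℕ) : PowerSeries ℤ :=
  ∏' n : ℕ, (1 - PowerSeries.X ^ (j * (n + 1)))

theorem multipliable_E {j : ℕ} (hj : 1 ≤ j) :
    Multipliable fun n : ℕ => (1 - PowerSeries.X ^ (j * (n + 1)) : PowerSeries ℤ) := by
  have h := PowerSeries.WithPiTopology.multipliable_one_add_of_tendsto_order_atTop_nhds_top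
    (R := ℤ) (f := fun n : ℕ => -(PowerSeries.X : PowerSeries ℤ) ^ (j * (n + 1))) (by
      refine ENat.tendsto_nhds_top_iff_natCast_lt.2 fun N => ?_
      filter_upwards [Filter.eventually_ge_atTop N] with n hn
      rw [PowerSeries.order_neg, PowerSeries.order_X_pow]
      exact_mod_cast (by nlinarith : N < j * (n + 1)))
  simpa [sub_eq_add_neg] using h

theorem constantCoeff_E {j : ℕ} (hj : 1 ≤ j) : PowerSeries.constantCoeff (E j) = 1 := by
  rw [E, (multipliable_E hj).map_tprod (PowerSeries.constantCoeff (R := ℤ))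
    (PowerSeries.WithPiTopology.continuous_constantCoeff ℤ)]
  have : ∀ n : ℕ, PowerSeries.constantCoeff
      (1 - PowerSeries.X ^ (j * (n + 1)) : PowerSeries ℤ) = 1 := by
    intro n
    have : j * (n + 1) ≠ 0 := by positivity
    simp [this]
  simp [this]

/-- The inverse `1 / E_j` in `ℤ⟦q⟧`, for `j ≥ 1`. -/
noncomputable def invE (j : ℕ) : PowerSeries ℤ := PowerSeries.invOfUnit (E j) 1

theorem E_mul_invE {j : ℕ} (hj : 1 ≤ j) : E j * invE j = 1 :=
  PowerSeries.mul_invOfUnit _ _ (by rw [constantCoeff_E hj]; rfl)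

/-- The first five rows of the matrix `m` (all other entries of these rows are `0`). -/
def mInit : ℕ → ℕ → ℕ
  | 1, 1 => 5
  | 2, 1 => 2 * 5
  | 2, 2 => 5 ^ 3
  | 3, 1 => 9
  | 3, 2 => 3 * 5 ^ 3
  | 3, 3 => 5 ^ 5
  | 4, 1 => 4
  | 4, 2 => 22 * 5 ^ 2
  | 4, 3 => 4 * 5 ^ 5
  | 4, 4 => 5 ^ 7
  | 5, 1 => 1
  | 5, 2 => 4 * 5 ^ 3
  | 5, 3 => 8 * 5 ^ 5
  | 5, 4 => 5 ^ 8
  | 5, 5 => 5 ^ 9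
  | _, _ => 0

/-- The infinite matrix `m(i, j)`, `i, j ≥ 1`; entries with `i = 0` or `j = 0` are set to `0`. -/
def m : ℕ → ℕ → ℕ
  | _, 0 => 0
  | _ + 6, 1 => 0
  | i + 6, j + 2 => 25 * m (i + 5) (j + 1) + 25 * m (i + 4) (j + 1) + 15 * m (i + 3) (j + 1)
      + 5 * m (i + 2) (j + 1) + m (i + 1) (j + 1)
  | i, j => mInit i j

/-- The values `b(1, k)`. -/
def bInit : ℕ → ℕ
  | 1 => 315
  | 2 => 52 * 5 ^ 4
  | 3 => 63 * 5 ^ 6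
  | 4 => 6 * 5 ^ 9
  | 5 => 5 ^ 11
  | _ => 0

/-- The array `b(j, k)`, `j, k ≥ 1`. The row `j = 0` is a placeholder. The sum over the integers
`i ≥ 1` has only finitely many nonzero terms, see `finite_support_b`. -/
noncomputable def b : ℕ → ℕ → ℕ
  | 0, _ => 0
  | 1, k => bInit k
  | j + 2, k => ∑ᶠ (i : ℕ) (_ : 1 ≤ i), b (j + 1) i * m (6 * i + 6) (k + i + 1)

theorem m_eq_zero (j i : ℕ) (h : 5 * j < i) : m i j = 0 := by
  induction j generalizing i with
  | zero => simp [m]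
  | succ j ih =>
    obtain ⟨i, rfl⟩ : ∃ i', i = i' + 6 := ⟨i - 6, by omega⟩
    cases j with
    | zero => simp [m]
    | succ j =>
      simp only [m]
      rw [ih (i + 5) (by omega), ih (i + 4) (by omega), ih (i + 3) (by omega),
        ih (i + 2) (by omega), ih (i + 1) (by omega)]

theorem finite_support_b (j k : ℕ) :
    (Function.support fun i : ℕ => b j i * m (6 * i + 6) (k + i + 1)).Finite := by
  refine (Set.finite_Iio (5 * k)).subset fun i hi => ?_
  by_contra hk
  exact hi (by simp only [Set.mem_Iio, not_lt] at hk; simp [m_eq_zero (k + i + 1) (6 * i + 6) (by omega)])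

end ColoredPartitions

/-! The generating function of `numColored 6` is `1 / E_1 ^ 6`, and one has to extract coefficients
in residue classes mod `5` repeatedly. Put `w = q E_25`, `xi = w / E_1` and `tau = q E_5 ^ 6 / E_1 ^
6`. Everything follows from the fact that `xi` is a root of a quintic over the series in `q ^ 5`:
`xi ^ 5 = tau(q ^ 5) (25 xi ^ 4 + 25 xi ^ 3 + 15 xi ^ 2 + 5 xi + 1)` (`xi_pow_add_five`).

The quintic comes from the dissection `E_1 = a - w + q ^ 2 c`, with `a`, `c` series in `q ^ 5`. The
pentagonal number theorem gives its shape (`E_one_eq`), and Jacobi's formula for `E_1 ^ 3` gives `a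
c = -E_25 ^ 2` (`dissection_relation`). The product of the five conjugates `E_1(ζ ^ k q)` can then
be computed in two ways: from the infinite products it is `E_5 ^ 6 / E_25`, and from the dissection
it is a polynomial in `E_1` and `w` without a `w ^ 5` term (`norm_mul_E_five`, `dil_norm`).

Extraction of the exponents divisible by `5` is linear over series in `q ^ 5`, so the extracted
powers of `xi` obey the recurrence defining `m` and equal `∑ m(i, j) tau ^ j` (`sect_xi_pow`). Up to
powers of `q` and factors in `q ^ 5`, both `1 / E_1 ^ 6` and each term of the claimed expansion are
powers `xi ^ (6 p)`. This gives the case `j = 1`, and each induction step multiplies the row of `b`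
by entries of `m`. -/

namespace ColoredPartitions

open PowerSeries

/-! ### Arithmetic progressions of coefficients modulo `5` -/

/-- The power series `∑ a(5 n + r) q ^ n` attached to `∑ a(n) q ^ n`. -/
noncomputable def sect (r : ℕ) : ℤ⟦X⟧ →+ ℤ⟦X⟧ where
  toFun f := mk fun n => coeff (5 * n + r) f
  map_zero' := by ext; simp
  map_add' f g := by ext; simp

@[simp]
theorem coeff_sect (r n : ℕ) (f : ℤ⟦X⟧) : coeff n (sect r f) = coeff (5 * n + r) f := by
  simp [sect]

/-- The substitution `q ↦ q ^ 5`. -/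
noncomputable abbrev dil : ℤ⟦X⟧ →ₐ[ℤ] ℤ⟦X⟧ := expand 5 (by norm_num)

theorem dil_X : dil X = X ^ 5 := expand_X 5 (by norm_num)

theorem coeff_X_pow_mul_dil (r s n : ℕ) (hr : r < 5) (hs : s < 5) (g : ℤ⟦X⟧) :
    coeff (5 * n + r) (X ^ s * dil g) = if r = s then coeff n g else 0 := by
  rw [coeff_X_pow_mul', coeff_expand]
  rcases eq_or_ne r s with rfl | h
  · have h5 : 5 * n + r - r = 5 * n := by omega
    simp [h5]
  · rw [if_neg h]
    split_ifs
    · omega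
    · rfl
    · rfl

theorem sect_X_pow_mul_dil (r s : ℕ) (hr : r < 5) (hs : s < 5) (g : ℤ⟦X⟧) :
    sect r (X ^ s * dil g) = if r = s then g else 0 := by
  ext n
  rw [coeff_sect, coeff_X_pow_mul_dil r s n hr hs]
  split_ifs <;> simp

theorem sect_decomposition (r : ℕ) (hr : r < 5) (g : ℕ → ℤ⟦X⟧) :
    sect r (dil (g 0) + X * dil (g 1) + X ^ 2 * dil (g 2) + X ^ 3 * dil (g 3)
      + X ^ 4 * dil (g 4)) = g r := by
  have h := fun s hs => sect_X_pow_mul_dil r s hr hs (g s)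
  have h0 := h 0 (by norm_num)
  have h1 := h 1 (by norm_num)
  rw [pow_zero, one_mul] at h0
  rw [pow_one] at h1
  rw [map_add, map_add, map_add, map_add, h0, h1, h 2 (by norm_num), h 3 (by norm_num),
    h 4 (by norm_num)]
  interval_cases r <;> simp

theorem eq_sum_sect (f : ℤ⟦X⟧) :
    f = dil (sect 0 f) + X * dil (sect 1 f) + X ^ 2 * dil (sect 2 f) + X ^ 3 * dil (sect 3 f)
      + X ^ 4 * dil (sect 4 f) := by
  ext n
  have hn : n = 5 * (n / 5) + n % 5 := by omega
  have h := congrArg (coeff (n / 5)) (sect_decomposition (n % 5) (Nat.mod_lt _ (by norm_num))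
    fun s => sect s f)
  rw [coeff_sect, coeff_sect, ← hn] at h
  exact h.symm

/-- Linearity of the extraction operator over series in `q ^ 5`; every later use of the modular
equation rests on it. -/
theorem sect_dil_mul (r : ℕ) (f g : ℤ⟦X⟧) (hr : r < 5) :
    sect r (dil g * f) = g * sect r f := by
  have h : dil g * f = dil (g * sect 0 f) + X * dil (g * sect 1 f) + X ^ 2 * dil (g * sect 2 f)
      + X ^ 3 * dil (g * sect 3 f) + X ^ 4 * dil (g * sect 4 f) := by
    simp only [map_mul]
    conv_lhs => rw [eq_sum_sect f]
    ring
  rw [h]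
  exact sect_decomposition r hr fun s => g * sect s f

theorem sect_zero_dil (g : ℤ⟦X⟧) : sect 0 (dil g) = g := by
  simpa using sect_X_pow_mul_dil 0 0 (by norm_num) (by norm_num) g

theorem dil_injective : Function.Injective dil := fun f g h => by
  rw [← sect_zero_dil f, h, sect_zero_dil]

theorem sect_zero_X_pow_mul (r : ℕ) (hr0 : 1 ≤ r) (hr : r ≤ 5) (f : ℤ⟦X⟧) :
    sect 0 (X ^ (5 + r) * f) = X ^ 2 * sect (5 - r) f := by
  ext n
  rw [coeff_sect, coeff_X_pow_mul', coeff_X_pow_mul']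
  rcases Nat.lt_or_ge n 2 with h | h
  · rw [if_neg (by omega), if_neg (by omega)]
  · rw [if_pos (by omega), if_pos h, coeff_sect]
    congr 2; omega

theorem continuous_dil : Continuous dil := by
  refine continuous_iff_continuousAt.2 fun f => ?_
  rw [ContinuousAt, WithPiTopology.tendsto_iff_coeff_tendsto]
  intro d
  simp only [coeff_expand]
  split_ifs
  · exact (WithPiTopology.continuous_coeff ℤ _).continuousAt
  · exact tendsto_const_nhds

theorem dil_E {j : ℕ} (hj : 1 ≤ j) : dil (E j) = E (5 * j) := by
  rw [E, (multipliable_E hj).map_tprod dil continuous_dil, E]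
  congr 1
  ext1 n
  rw [map_sub, map_one, map_pow, dil_X, ← pow_mul, mul_assoc]

theorem hasProd_E {j : ℕ} (hj : 1 ≤ j) :
    HasProd (fun n : ℕ => (1 - X ^ (j * (n + 1)) : ℤ⟦X⟧)) (E j) :=
  (multipliable_E hj).hasProd

/-! ### The pentagonal number theorem and the `5`-dissection of `E 1` -/

theorem E_one_eq_pentagonalSeries : E 1 = pentagonalSeries ℤ := by
  rw [E, ← WithPiTopology.tprod_one_sub_X_pow]
  simp

/-- The residue of `k (3 k - 1) / 2` mod `5` depends only on `k` mod `5`. Residues `3` and `4` never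
occur, so `E 1` has a three-term dissection. -/
theorem pentagonal_mod_five (k : ℤ) :
    pentagonal k % 5 = 0 ∨ pentagonal k % 5 = 1 ∧ k % 5 = 1 ∨ pentagonal k % 5 = 2 := by
  have h := two_mul_natCast_pentagonal k
  obtain ⟨m, hm⟩ : ∃ m, k = 5 * m + k % 5 := ⟨k / 5, by omega⟩
  have hk : k % 5 = 0 ∨ k % 5 = 1 ∨ k % 5 = 2 ∨ k % 5 = 3 ∨ k % 5 = 4 := by omega
  obtain ⟨c, hc⟩ : ∃ c : ℤ, 2 * (pentagonal k : ℤ) = 5 * c + (k % 5) * (3 * (k % 5) - 1) := by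
    rw [h]
    generalize k % 5 = r at hm
    subst hm
    exact ⟨15 * m ^ 2 + 6 * m * r - m, by ring⟩
  rcases hk with hk | hk | hk | hk | hk <;> rw [hk] at hc <;> omega

theorem pentagonal_five_mul_add_one (j : ℤ) :
    pentagonal (5 * j + 1) = 5 * (5 * pentagonal (-j)) + 1 := by
  have h1 := two_mul_natCast_pentagonal (5 * j + 1)
  have h2 := two_mul_natCast_pentagonal_neg j
  zify
  linarith

theorem sect_E_one_eq_zero (r : ℕ) (hr : r = 3 ∨ r = 4) : sect r (E 1) = 0 := by
  ext n
  rw [coeff_sect, E_one_eq_pentagonalSeries, map_zero]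
  refine coeff_pentagonalSeries_eq_zero ℤ ?_
  rintro ⟨k, hk⟩
  have := pentagonal_mod_five k
  omega

/-- Only the indices `5 j + 1` contribute, with exponent `25 * pentagonal (-j) + 1` and sign `-(-1)
^ j`: a dilated copy of the pentagonal series with opposite sign. -/
theorem sect_one_E_one : sect 1 (E 1) = -E 5 := by
  ext n
  rw [← mul_one 5, ← dil_E le_rfl, coeff_sect, E_one_eq_pentagonalSeries, map_neg, coeff_expand]
  by_cases h : 5 * n + 1 ∈ Set.range pentagonal
  · obtain ⟨k, hk⟩ := h
    have := pentagonal_mod_five k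
    obtain ⟨j, rfl⟩ : ∃ j, k = 5 * j + 1 := ⟨k / 5, by omega⟩
    have hn : n = 5 * pentagonal (-j) := by
      have := pentagonal_five_mul_add_one j
      omega
    rw [← hk, coeff_pentagonalSeries_pentagonal, if_pos ⟨_, hn⟩, hn,
      Nat.mul_div_cancel_left _ (by norm_num), coeff_pentagonalSeries_pentagonal,
      Int.negOnePow_succ, Int.negOnePow_neg,
      (Int.negOnePow_eq_iff (5 * j) j).2 ⟨2 * j, by ring⟩]
    simp
  · rw [coeff_pentagonalSeries_eq_zero ℤ h]
    split_ifs with h5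
    · obtain ⟨t, rfl⟩ := h5
      rw [Nat.mul_div_cancel_left _ (by norm_num), coeff_pentagonalSeries_eq_zero ℤ, neg_zero]
      rintro ⟨k, rfl⟩
      exact h ⟨5 * (-k) + 1, by rw [pentagonal_five_mul_add_one, neg_neg]⟩
    · simp

theorem E_one_eq :
    E 1 = dil (sect 0 (E 1)) - X * dil (E 5) + X ^ 2 * dil (sect 2 (E 1)) := by
  conv_lhs => rw [eq_sum_sect (E 1)]
  rw [sect_one_E_one, sect_E_one_eq_zero 3 (by simp), sect_E_one_eq_zero 4 (by simp)]
  simp only [map_neg, map_zero]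
  ring

/-! ### The generating function of `k`-colored partitions -/

/-- The parts of color `i` in a multiset of colored parts. -/
def partsOfColor {k : ℕ} (i : Fin k) (s : Multiset (ℕ × Fin k)) : Multiset ℕ :=
  (s.filter fun x => x.2 = i).map Prod.fst

/-- Attaching the color `i` to the members of `f i`, for all `i`. -/
def colorParts {k : ℕ} (f : Fin k → Multiset ℕ) : Multiset (ℕ × Fin k) :=
  ∑ i, (f i).map fun a => (a, i)

theorem partsOfColor_colorParts {k : ℕ} (f : Fin k → Multiset ℕ) (i : Fin k) :
    partsOfColor i (colorParts f) = f i := by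
  have h : ∀ j, partsOfColor i ((f j).map fun a => (a, j)) = if j = i then f j else 0 := by
    intro j
    rw [partsOfColor, Multiset.filter_map]
    split_ifs with hj <;> simp [hj]
  have hadd : partsOfColor i (colorParts f) = ∑ j, partsOfColor i ((f j).map fun a => (a, j)) :=
    map_sum (⟨⟨partsOfColor i, rfl⟩, fun s t => by simp [partsOfColor]⟩ :
      Multiset (ℕ × Fin k) →+ Multiset ℕ) _ _
  rw [hadd]
  simp [h]

theorem colorParts_partsOfColor {k : ℕ} (s : Multiset (ℕ × Fin k)) :
    colorParts (fun i => partsOfColor i s) = s := by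
  induction s using Multiset.induction_on with
  | empty => simp [colorParts, partsOfColor]
  | cons x s ih =>
    have h : ∀ i, (partsOfColor i (x ::ₘ s)).map (fun a => (a, i))
        = (if x.2 = i then {x} else 0) + (partsOfColor i s).map fun a => (a, i) := by
      intro i
      by_cases hx : x.2 = i
      · subst hx
        simp [partsOfColor]
      · simp [partsOfColor, hx]
    rw [colorParts, Finset.sum_congr rfl fun i _ => h i, Finset.sum_add_distrib]
    rw [colorParts] at ih
    rw [ih]
    simp

theorem sum_map_fst_colorParts {k : ℕ} (f : Fin k → Multiset ℕ) :
    ((colorParts f).map Prod.fst).sum = ∑ i, (f i).sum := by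
  have h := map_sum (Multiset.sumAddMonoidHom.comp (Multiset.mapAddMonoidHom Prod.fst))
    (fun i => (f i).map fun a => (a, i)) Finset.univ
  exact h.trans (by simp)

/-- The `k`-colored partitions whose parts of color `i` sum to `l i` are the families of partitions
of the numbers `l i`. -/
def fiberEquiv {k n : ℕ} (l : Fin k → ℕ) (hl : ∑ i, l i = n) :
    {c : ColoredPartition k n // (fun i => (partsOfColor i c.parts).sum) = l} ≃
      ∀ i, Nat.Partition (l i) where
  toFun c i :=
    { parts := partsOfColor i c.1.parts
      parts_pos := by
        intro a ha
        simp only [partsOfColor, Multiset.mem_map, Multiset.mem_filter] at ha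
        obtain ⟨x, ⟨hx, -⟩, rfl⟩ := ha
        exact c.1.parts_pos x hx
      parts_sum := congrFun c.2 i }
  invFun f :=
    ⟨{ parts := colorParts fun i => (f i).parts
       parts_pos := by
         intro x hx
         simp only [colorParts, Multiset.mem_sum, Multiset.mem_map] at hx
         obtain ⟨i, -, a, ha, rfl⟩ := hx
         exact (f i).parts_pos ha
       parts_sum := by
         rw [sum_map_fst_colorParts, ← hl]
         exact Finset.sum_congr rfl fun i _ => (f i).parts_sum }, by
      funext i
      rw [partsOfColor_colorParts]
      exact (f i).parts_sum⟩
  left_inv c := Subtype.ext (ColoredPartition.ext (colorParts_partsOfColor _))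
  right_inv f := funext fun i => Nat.Partition.ext (partsOfColor_colorParts _ i)

theorem sum_sum_partsOfColor {k n : ℕ} (c : ColoredPartition k n) :
    ∑ i, (partsOfColor i c.parts).sum = n := by
  rw [← sum_map_fst_colorParts, colorParts_partsOfColor, c.parts_sum]

theorem numColored_eq_sum (k n : ℕ) :
    numColored k n = ∑ l ∈ Finset.finsuppAntidiag (Finset.univ : Finset (Fin k)) n,
      ∏ i, Fintype.card (Nat.Partition (l i)) := by
  classical
  have := Fintype.ofFinite (ColoredPartition k n)
  let w : ColoredPartition k n → Fin k →₀ ℕ := fun c =>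
    Finsupp.equivFunOnFinite.symm fun i => (partsOfColor i c.parts).sum
  have hw : ∀ c ∈ Finset.univ, w c ∈ Finset.finsuppAntidiag (Finset.univ : Finset (Fin k)) n := by
    intro c _
    rw [Finset.mem_finsuppAntidiag]
    exact ⟨by simpa [w] using sum_sum_partsOfColor c, Finset.subset_univ _⟩
  rw [numColored, Nat.card_eq_fintype_card, ← Finset.card_univ,
    Finset.card_eq_sum_card_fiberwise hw]
  refine Finset.sum_congr rfl fun l hl => ?_
  rw [Finset.mem_finsuppAntidiag] at hl
  rw [← Fintype.card_pi, ← Fintype.card_congr (fiberEquiv (l : Fin k → ℕ) hl.1),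
    Fintype.card_subtype]
  congr 1
  ext c
  simp only [Finset.mem_filter, Finset.mem_univ, true_and, w]
  rw [Equiv.symm_apply_eq]
  rfl

theorem mk_numColored (k : ℕ) :
    (mk fun n => (numColored k n : ℤ)) = (mk fun n => (Fintype.card n.Partition : ℤ)) ^ k := by
  ext n
  have h := coeff_prod (R := ℤ) (fun _ : Fin k => mk fun n => (Fintype.card n.Partition : ℤ))
    n Finset.univ
  rw [Finset.prod_const, Finset.card_univ, Fintype.card_fin] at h
  rw [h, coeff_mk, numColored_eq_sum]
  push_cast
  simp

theorem mk_card_partition_mul_E_one :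
    (mk fun n => (Fintype.card n.Partition : ℤ)) * E 1 = 1 := by
  have h1 := Nat.Partition.hasProd_powerSeriesMk_card_restricted ℤ fun _ => True
  have h2 := h1.mul (hasProd_E le_rfl)
  have h3 : ∀ i : ℕ, (if True then ∑' j : ℕ, (X : ℤ⟦X⟧) ^ ((i + 1) * j) else 1)
      * (1 - X ^ (1 * (i + 1))) = 1 := by
    intro i
    simp only [if_true, one_mul, pow_mul]
    exact WithPiTopology.tsum_pow_mul_one_sub_of_constantCoeff_eq_zero (by simp)
  simp only [h3] at h2
  have h4 := h2.unique hasProd_one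
  rw [← h4]
  congr 2
  ext1 n
  simp [Nat.Partition.restricted]

theorem mk_numColored_eq_invE_pow (k : ℕ) :
    (mk fun n => (numColored k n : ℤ)) = invE 1 ^ k := by
  rw [mk_numColored]
  congr 1
  calc _ = (mk fun n => (Fintype.card n.Partition : ℤ)) * (E 1 * invE 1) := by
        rw [E_mul_invE le_rfl, mul_one]
    _ = invE 1 := by rw [← mul_assoc, mk_card_partition_mul_E_one, one_mul]

/-! ### Jacobi's identity for the cube of `E 1` -/

/-- The finite product `(q; q)_n`. -/
noncomputable def qPoch (n : ℕ) : ℤ⟦X⟧ := ∏ i ∈ Finset.range n, (1 - X ^ (i + 1))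

theorem qPoch_succ (n : ℕ) : qPoch (n + 1) = qPoch n * (1 - X ^ (n + 1)) :=
  Finset.prod_range_succ _ _

theorem qPoch_zero : qPoch 0 = 1 := Finset.prod_range_zero _

theorem isUnit_qPoch (n : ℕ) : IsUnit (qPoch n) := by
  rw [isUnit_iff_constantCoeff]
  simp [qPoch, map_prod]

theorem coeff_qPoch_eq {d m n : ℕ} (hm : d ≤ m) (hmn : m ≤ n) :
    coeff d (qPoch n) = coeff d (qPoch m) := by
  induction n, hmn using Nat.le_induction with
  | base => rfl
  | succ n hn ih =>
    rw [qPoch_succ, mul_sub, mul_one, map_sub, ih, coeff_mul_X_pow', if_neg (by omega), sub_zero]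

theorem coeff_E_one {d m : ℕ} (hm : d ≤ m) : coeff d (E 1) = coeff d (qPoch m) := by
  have h := (hasProd_E le_rfl).tendsto_prod_nat
  rw [WithPiTopology.tendsto_iff_coeff_tendsto] at h
  refine tendsto_nhds_unique (h d) (tendsto_const_nhds.congr' ?_)
  filter_upwards [Filter.eventually_ge_atTop m] with n hn
  simpa [qPoch] using (coeff_qPoch_eq hm hn).symm

theorem X_pow_dvd_E_one_sub_qPoch {N m : ℕ} (h : N ≤ m) : X ^ N ∣ E 1 - qPoch m := by
  rw [X_pow_dvd_iff]
  intro d hd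
  rw [map_sub, coeff_E_one (by omega : d ≤ m), sub_self]

/-- The coefficient of `z ^ (k + 1)` in `-∏_{i ≤ n} (1 - z q ^ i) ∏_{1 ≤ i ≤ n} (1 - q ^ i / z)`. -/
noncomputable def thetaCoeff : ℕ → ℕ → ℤ⟦X⟧
  | 0, 0 => 1
  | 0, _ + 1 => 0
  | n + 1, 0 => (1 + X ^ (2 * n + 2)) * thetaCoeff n 0
      - X ^ (n + 1) * (thetaCoeff n 1 - thetaCoeff n 0)
  | n + 1, k + 1 => (1 + X ^ (2 * n + 2)) * thetaCoeff n (k + 1)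
      - X ^ (n + 1) * (thetaCoeff n k + thetaCoeff n (k + 2))

theorem thetaCoeff_eq_zero {n k : ℕ} (h : n < k) : thetaCoeff n k = 0 := by
  induction n generalizing k with
  | zero =>
    obtain ⟨k, rfl⟩ := Nat.exists_eq_add_one_of_ne_zero h.ne'
    rfl
  | succ n ih =>
    obtain ⟨k, rfl⟩ := Nat.exists_eq_add_one_of_ne_zero (by omega : k ≠ 0)
    rw [thetaCoeff, ih (by omega), ih (by omega), ih (by omega)]
    simp

/-- The weight `2 k + 1` comes from differentiating the finite triple product at `z = 1`: the
exponents `k + 1` and `-k` carry opposite coefficients, and the factor `1 - z` vanishes there.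
Truncation at `M` leaves the boundary term. -/
theorem sum_thetaCoeff_succ (n M : ℕ) :
    ∑ k ∈ Finset.range (M + 1), (2 * (k : ℤ⟦X⟧) + 1) * thetaCoeff (n + 1) k
      = (1 - X ^ (n + 1)) ^ 2 *
          ∑ k ∈ Finset.range (M + 1), (2 * (k : ℤ⟦X⟧) + 1) * thetaCoeff n k
        + X ^ (n + 1) * ((2 * (M : ℤ⟦X⟧) + 3) * thetaCoeff n M
          - (2 * (M : ℤ⟦X⟧) + 1) * thetaCoeff n (M + 1)) := by
  induction M with
  | zero =>
    simp only [zero_add, Finset.sum_range_one, thetaCoeff]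
    push_cast
    ring
  | succ M ih =>
    rw [Finset.sum_range_succ, ih, Finset.sum_range_succ _ (M + 1), thetaCoeff]
    push_cast
    ring

theorem sum_thetaCoeff {n M : ℕ} (h : n ≤ M) :
    ∑ k ∈ Finset.range (M + 1), (2 * (k : ℤ⟦X⟧) + 1) * thetaCoeff n k = qPoch n ^ 2 := by
  induction n with
  | zero =>
    rw [Finset.sum_range_succ', Finset.sum_eq_zero fun k _ => by
      rw [thetaCoeff_eq_zero (Nat.succ_pos k), mul_zero]]
    simp [thetaCoeff, qPoch_zero]
  | succ n ih =>
    rw [sum_thetaCoeff_succ, ih (by omega), thetaCoeff_eq_zero (by omega : n < M),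
      thetaCoeff_eq_zero (by omega : n < M + 1), qPoch_succ]
    ring

/-- The triangular number `k (k + 1) / 2`. -/
def triangular : ℕ → ℕ
  | 0 => 0
  | k + 1 => triangular k + (k + 1)

/-- Closed form of the finite Jacobi triple product: with `n = p + k`, the coefficient is a signed
power of `q` times a `q`-binomial of `2 n + 1`, here with denominators cleared. -/
theorem thetaCoeff_mul_qPoch (p k : ℕ) :
    thetaCoeff (p + k) k * (qPoch p * qPoch (p + 2 * k + 1))
      = (-1) ^ k * X ^ triangular k * qPoch (2 * (p + k) + 1) := by
  obtain ⟨n, hn⟩ : ∃ n, n = p + k := ⟨_, rfl⟩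
  rw [← hn]
  induction n generalizing p k with
  | zero =>
    obtain ⟨rfl, rfl⟩ : p = 0 ∧ k = 0 := by omega
    simp [thetaCoeff, triangular, qPoch_zero]
  | succ n ih =>
    have hQ : qPoch (2 * (n + 1) + 1) = qPoch (2 * n + 1) * (1 - X ^ (2 * n + 2))
        * (1 - X ^ (2 * n + 3)) := by
      rw [← qPoch_succ, ← qPoch_succ, show 2 * n + 1 + 1 + 1 = 2 * (n + 1) + 1 by ring]
    have hA : ∀ p k, n = p + k → thetaCoeff n k * (qPoch p * qPoch (p + 2 * k + 1))
        = (-1) ^ k * X ^ triangular k * qPoch (2 * n + 1) := fun p k h => ih p k h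
    have hB : ∀ p k, n = p + k → thetaCoeff n (k + 1) * (qPoch p * qPoch (p + 2 * k + 2))
        = (-1) ^ (k + 1) * X ^ (triangular k + (k + 1)) * (1 - X ^ p) * qPoch (2 * n + 1) := by
      intro p k h
      cases p with
      | zero => rw [thetaCoeff_eq_zero (by omega)]; simp
      | succ p =>
        have := hA p (k + 1) (by omega)
        rw [show p + 2 * (k + 1) + 1 = p + 1 + 2 * k + 2 by ring, triangular] at this
        rw [qPoch_succ p]
        linear_combination (1 - X ^ (p + 1)) * this
    rw [hQ]
    cases k with
    | zero =>
      obtain rfl : p = n + 1 := by omega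
      have h0 := hA n 0 rfl
      have h1 := hB n 0 rfl
      simp only [mul_zero, add_zero, pow_zero, one_mul, zero_add, triangular, pow_one] at h0 h1 ⊢
      rw [thetaCoeff, qPoch_succ (n + 1)]
      rw [qPoch_succ (n + 1)] at h1
      rw [qPoch_succ n] at h0 h1 ⊢
      linear_combination ((1 + X ^ (2 * n + 2)) + X ^ (n + 1)) * (1 - X ^ (n + 1))
        * (1 - X ^ (n + 2)) * h0 - X ^ (n + 1) * (1 - X ^ (n + 1)) * h1
    | succ k =>
      obtain rfl : n = p + k := by omega
      have h0 := hA p k rfl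
      have h1 := hB p k rfl
      -- The extra factor `X` turns `1 - X ^ (p - 1)` into `X ^ 1 - X ^ p`, which avoids truncated
      -- subtraction at `p = 0`; it is cancelled at the end.
      have h2 : thetaCoeff (p + k) (k + 2) * (qPoch p * qPoch (p + 2 * k + 3)) * X ^ 1
          = (-1) ^ (k + 2) * X ^ (triangular k + 2 * k + 3) * (1 - X ^ p) * (X ^ 1 - X ^ p)
            * qPoch (2 * (p + k) + 1) := by
        cases p with
        | zero => rw [thetaCoeff_eq_zero (by omega)]; simp
        | succ p =>
          have := hB p (k + 1) (by omega)
          rw [show p + 2 * (k + 1) + 2 = p + 1 + 2 * k + 3 by ring, triangular] at this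
          rw [qPoch_succ p]
          linear_combination X * (1 - X ^ (p + 1)) * this
      rw [show p + 2 * (k + 1) + 1 = p + 2 * k + 3 by ring, thetaCoeff, triangular]
      rw [qPoch_succ (p + 2 * k + 2)] at h2 ⊢
      rw [qPoch_succ (p + 2 * k + 1)] at h1 h2 ⊢
      refine mul_right_cancel₀ (X_ne_zero (R := ℤ)) ?_
      linear_combination X * (1 + X ^ (2 * (p + k) + 2)) * (1 - X ^ (p + 2 * k + 3)) * h1
        - X * X ^ (p + k + 1) * (1 - X ^ (p + 2 * k + 2)) * (1 - X ^ (p + 2 * k + 3)) * h0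
        - X ^ (p + k + 1) * h2

theorem le_triangular (k : ℕ) : k ≤ triangular k := by
  cases k with
  | zero => exact le_rfl
  | succ k => rw [triangular]; omega

/-- **Jacobi's identity** for `∏ (1 - q ^ n) ^ 3`, modulo `q ^ N`. -/
theorem X_pow_dvd_E_one_pow_three_sub (N : ℕ) :
    X ^ N ∣ E 1 ^ 3
      - ∑ k ∈ Finset.range N, (-1) ^ k * (2 * (k : ℤ⟦X⟧) + 1) * X ^ triangular k := by
  let I : Ideal ℤ⟦X⟧ := Ideal.span {X ^ N}
  let π := Ideal.Quotient.mk I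
  have hπ : ∀ f g, X ^ N ∣ f - g ↔ π f = π g := fun f g => by
    rw [Ideal.Quotient.eq, Ideal.mem_span_singleton]
  have hE : ∀ m, N ≤ m → π (qPoch m) = π (E 1) := fun m hm =>
    ((hπ _ _).1 (X_pow_dvd_E_one_sub_qPoch hm)).symm
  have hX : ∀ m, N ≤ m → π (X ^ m) = 0 := fun m hm =>
    Ideal.Quotient.eq_zero_iff_mem.2 (Ideal.mem_span_singleton.2 (pow_dvd_pow _ hm))
  have hu : IsUnit (π (E 1)) := by
    rw [← hE N le_rfl]
    exact (isUnit_qPoch N).map π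
  -- With `n = 2 N` and `k < N`, all three `qPoch` indices in the closed form are at least `N`, so
  -- each factor is `E 1` modulo `q ^ N`.
  have hsmall : ∀ k < N, π (thetaCoeff (2 * N) k) * π (E 1) = (-1) ^ k * π (X ^ triangular k) := by
    intro k hk
    have h := congrArg π (thetaCoeff_mul_qPoch (2 * N - k) k)
    rw [show 2 * N - k + k = 2 * N by omega] at h
    simp only [map_mul] at h
    rw [hE _ (by omega), hE _ (by omega), hE _ (by omega), ← mul_assoc] at h
    simpa using hu.mul_right_cancel h
  have hlarge : ∀ k, N ≤ k → π (thetaCoeff (2 * N) k) = 0 := by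
    intro k hk
    rcases Nat.lt_or_ge (2 * N) k with h2 | h2
    · rw [thetaCoeff_eq_zero h2, map_zero]
    · have h := congrArg π (thetaCoeff_mul_qPoch (2 * N - k) k)
      rw [show 2 * N - k + k = 2 * N by omega, map_mul, map_mul, map_mul, map_mul,
        hX _ (hk.trans (le_triangular k)), mul_zero, zero_mul] at h
      exact (((isUnit_qPoch _).mul (isUnit_qPoch _)).map π).mul_left_eq_zero.1 h
  have hsum := congrArg π (sum_thetaCoeff (n := 2 * N) (M := 2 * N) le_rfl)
  rw [map_pow, hE _ (by omega), map_sum,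
    ← Finset.sum_range_add_sum_Ico _ (by omega : N ≤ 2 * N + 1),
    Finset.sum_eq_zero (s := Finset.Ico N (2 * N + 1)) fun k hk => by
      rw [map_mul, hlarge k (Finset.mem_Ico.1 hk).1, mul_zero], add_zero] at hsum
  rw [hπ, map_pow, pow_succ, ← hsum, Finset.sum_mul, map_sum]
  refine Finset.sum_congr rfl fun k hk => ?_
  rw [map_mul, mul_assoc, hsmall k (Finset.mem_range.1 hk)]
  simp only [map_mul, map_pow, map_neg, map_one]
  ring

theorem two_mul_triangular (k : ℕ) : 2 * triangular k = k * (k + 1) := by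
  induction k with
  | zero => rfl
  | succ k ih => rw [triangular, mul_add, ih]; ring

theorem triangular_mod_five_ne_two (k : ℕ) : triangular k % 5 ≠ 2 := by
  intro h
  have h2 := two_mul_triangular k
  have h4 : k * (k + 1) % 5 = 4 := by omega
  rw [Nat.mul_mod, Nat.add_mod] at h4
  have : k % 5 < 5 := Nat.mod_lt _ (by norm_num)
  interval_cases k % 5 <;> simp at h4

theorem sect_two_E_one_pow_three : sect 2 (E 1 ^ 3) = 0 := by
  ext n
  have h := X_pow_dvd_iff.1 (X_pow_dvd_E_one_pow_three_sub (5 * n + 3)) (5 * n + 2) (by omega)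
  rw [map_sub, sub_eq_zero] at h
  rw [coeff_sect, h, map_sum, map_zero]
  refine Finset.sum_eq_zero fun k _ => ?_
  have hc : ((-1) ^ k * (2 * (k : ℤ⟦X⟧) + 1)) = C ((-1) ^ k * (2 * (k : ℤ) + 1)) := by simp
  rw [hc, coeff_C_mul, coeff_X_pow, if_neg, mul_zero]
  have := triangular_mod_five_ne_two k
  omega

/-! ### The `5`-dissection and the norm of `E 1` -/

theorem sect_of_eq {f : ℤ⟦X⟧} (r : Fin 5) (g : Fin 5 → ℤ⟦X⟧)
    (h : f = dil (g 0) + X * dil (g 1) + X ^ 2 * dil (g 2) + X ^ 3 * dil (g 3)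
      + X ^ 4 * dil (g 4)) : sect r f = g r := by
  have := sect_decomposition r r.2 fun n => g (Fin.ofNat 5 n)
  rw [h]
  refine this.trans ?_
  simp

/-- By Jacobi, the exponents of `E 1 ^ 3` are triangular numbers, never `2` mod `5`. Cubing the
dissection, the component of residue `2` is `3 a (b ^ 2 + a c)`, and `3 a` can be cancelled. -/
theorem dissection_relation : sect 0 (E 1) * sect 2 (E 1) = -E 5 ^ 2 := by
  have he := E_one_eq
  set a := sect 0 (E 1) with ha
  set c := sect 2 (E 1)
  set b := E 5
  have h := sect_of_eq (f := E 1 ^ 3) 2 ![-3 * X * b * c ^ 2 + a ^ 3, X * c ^ 3 - 3 * a ^ 2 * b,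
    3 * a * b ^ 2 + 3 * a ^ 2 * c, -b ^ 3 - 6 * a * b * c, 3 * b ^ 2 * c + 3 * a * c ^ 2] (by
      rw [he]
      simp only [Matrix.cons_val, map_add, map_sub, map_neg, map_mul, map_pow, map_ofNat, dil_X]
      ring)
  have h2 : sect 2 (E 1 ^ 3) = 0 := sect_two_E_one_pow_three
  have h3 : 3 * a * b ^ 2 + 3 * a ^ 2 * c = 0 := by
    rw [← h2]
    exact h.symm
  have ha0 : a ≠ 0 := by
    intro h0
    have h1 := congrArg (coeff 0) ha
    rw [h0, coeff_sect, map_zero, mul_zero, zero_add, coeff_zero_eq_constantCoeff_apply,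
      constantCoeff_E le_rfl] at h1
    exact zero_ne_one h1
  have h30 : (3 : ℤ⟦X⟧) ≠ 0 := by
    rw [← map_ofNat (C (R := ℤ)) 3, Ne, map_eq_zero_iff _ C_injective]
    norm_num
  have h4 : 3 * a ≠ 0 := mul_ne_zero h30 ha0
  refine mul_left_cancel₀ h4 ?_
  linear_combination h3

/-- Pairing `k` with `5 - k` gives `u + (z + z ^ 4) v` and `u + (z ^ 2 + z ^ 3) v`; the two sums of
roots of unity have sum `-1` and product `-1`. -/
theorem prod_conjugates {R : Type*} [CommRing R] {z : R} (hz : 1 + z + z ^ 2 + z ^ 3 + z ^ 4 = 0)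
    (a w c : R) :
    ∏ k ∈ Finset.range 5, (a - z ^ k * w - (z ^ k) ^ 2 * c) =
      (a - w - c) * ((a ^ 2 + w ^ 2 + c ^ 2 + a * c) ^ 2
        - (a ^ 2 + w ^ 2 + c ^ 2 + a * c) * (a * c - a * w + w * c)
        - (a * c - a * w + w * c) ^ 2) := by
  have h5 : z ^ 5 = 1 := by linear_combination (z - 1) * hz
  set u := a ^ 2 + w ^ 2 + c ^ 2 + a * c with hu
  set v := a * c - a * w + w * c with hv
  have h1 : (a - z * w - z ^ 2 * c) * (a - z ^ 4 * w - (z ^ 4) ^ 2 * c) = u + (z + z ^ 4) * v := by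
    rw [hu, hv]
    linear_combination (w ^ 2 + (z ^ 4 + z) * w * c + (z ^ 5 + 1) * c ^ 2 - z ^ 3 * a * c) * h5
      - a * c * hz
  have h2 : (a - z ^ 2 * w - (z ^ 2) ^ 2 * c) * (a - z ^ 3 * w - (z ^ 3) ^ 2 * c)
      = u + (z ^ 2 + z ^ 3) * v := by
    rw [hu, hv]
    linear_combination (w ^ 2 + (z ^ 3 + z ^ 2) * w * c + (z ^ 5 + 1) * c ^ 2 - z * a * c) * h5
      - a * c * hz
  have h3 : (u + (z + z ^ 4) * v) * (u + (z ^ 2 + z ^ 3) * v) = u ^ 2 - u * v - v ^ 2 := by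
    linear_combination (u * v + v ^ 2) * hz + v ^ 2 * (z + z ^ 2) * h5
  rw [← h3, ← h1, ← h2]
  simp only [Finset.prod_range_succ, Finset.prod_range_zero]
  ring

theorem prod_conjugates_of_mul_eq {R : Type*} [CommRing R] {z : R}
    (hz : 1 + z + z ^ 2 + z ^ 3 + z ^ 4 = 0) {a w c : R} (h : a * c = w ^ 2) :
    ∏ k ∈ Finset.range 5, (a - z ^ k * w - (z ^ k) ^ 2 * c) = a ^ 5 - 11 * w ^ 5 - c ^ 5 := by
  rw [prod_conjugates hz]
  linear_combination -(10 * w ^ 3 + 5 * a * c * w) * h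

/-- A primitive fifth root of unity. -/
noncomputable def zeta : ℂ := Complex.exp (2 * Real.pi * Complex.I / (5 : ℕ))

theorem zeta_spec : IsPrimitiveRoot zeta 5 := Complex.isPrimitiveRoot_exp 5 (by norm_num)

theorem geom_sum_zeta_pow {n : ℕ} (hn : ¬ 5 ∣ n) :
    1 + zeta ^ n + (zeta ^ n) ^ 2 + (zeta ^ n) ^ 3 + (zeta ^ n) ^ 4 = 0 := by
  have h := (zeta_spec.pow_of_coprime n
    ((Nat.Prime.coprime_iff_not_dvd Nat.prime_five).2 hn).symm).geom_sum_eq_zero (by norm_num)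
  simpa [Finset.sum_range_succ] using h

/-- The ring homomorphism `f(q) ↦ f(ζ ^ k q)`. -/
noncomputable def conj (k : ℕ) : ℤ⟦X⟧ →+* ℂ⟦X⟧ :=
  (rescale (zeta ^ k)).comp (map (Int.castRingHom ℂ))

theorem coeff_conj (k n : ℕ) (f : ℤ⟦X⟧) :
    coeff n (conj k f) = (zeta ^ k) ^ n * ((coeff n f : ℤ) : ℂ) := by
  simp [conj]

theorem conj_X (k : ℕ) : conj k X = C zeta ^ k * X := by
  rw [conj, RingHom.comp_apply, map_X, rescale_X, map_pow]

theorem conj_dil (k : ℕ) (f : ℤ⟦X⟧) : conj k (dil f) = conj 0 (dil f) := by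
  ext n
  rw [coeff_conj, coeff_conj, coeff_expand]
  split_ifs with h
  · obtain ⟨n, rfl⟩ := h
    rw [← pow_mul, mul_comm k, pow_mul, pow_mul, zeta_spec.pow_eq_one]
    simp
  · simp

theorem conj_zero_injective : Function.Injective (conj 0) := by
  intro f g h
  ext n
  have := congrArg (coeff n) h
  rw [coeff_conj, coeff_conj] at this
  simpa using this

theorem continuous_conj (k : ℕ) : Continuous (conj k) := by
  refine continuous_iff_continuousAt.2 fun f => ?_
  rw [ContinuousAt, WithPiTopology.tendsto_iff_coeff_tendsto]
  intro d
  simp only [coeff_conj]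
  exact (continuous_const.mul
    ((continuous_of_discreteTopology (f := fun n : ℤ => (n : ℂ))).comp (WithPiTopology.continuous_coeff ℤ d))).continuousAt

theorem hasProd_conj_E (k : ℕ) {j : ℕ} (hj : 1 ≤ j) :
    HasProd (fun n : ℕ => (1 - (C zeta ^ k * X) ^ (j * (n + 1)) : ℂ⟦X⟧)) (conj k (E j)) := by
  have h := (hasProd_E hj).map (conj k) (continuous_conj k)
  simpa [Function.comp_def, conj_X] using h

/-- Padding with factors `1` puts `E (5 * j)` on the same index set as the conjugate product, so
that the products can be compared factor by factor. -/
theorem hasProd_conj_zero_E_five_mul {j : ℕ} (hj : 1 ≤ j) :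
    HasProd (fun n : ℕ => if 5 ∣ n + 1 then (1 - X ^ (j * (n + 1)) : ℂ⟦X⟧) else 1)
      (conj 0 (E (5 * j))) := by
  have hinj : Function.Injective fun n : ℕ => 5 * n + 4 := fun m n h => by
    simpa using h
  rw [← hinj.hasProd_iff]
  · convert hasProd_conj_E 0 (show 1 ≤ 5 * j by omega) using 2 with n
    have h5 : 5 ∣ 5 * n + 4 + 1 := ⟨n + 1, by ring⟩
    simp only [Function.comp_apply, if_pos h5, pow_zero, one_mul]
    congr 2
    ring
  · intro n hn
    rw [if_neg]
    rintro ⟨t, ht⟩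
    exact hn ⟨t - 1, by dsimp only; omega⟩

theorem prod_one_sub_conj (n : ℕ) :
    (∏ k ∈ Finset.range 5, (1 - (C zeta ^ k * X) ^ n : ℂ⟦X⟧))
      = if 5 ∣ n then (1 - X ^ n) ^ 5 else 1 - X ^ (5 * n) := by
  split_ifs with h
  · obtain ⟨n, rfl⟩ := h
    have hC : (C zeta : ℂ⟦X⟧) ^ 5 = 1 := by rw [← map_pow, zeta_spec.pow_eq_one, map_one]
    have hk : ∀ k, (1 - (C zeta ^ k * X) ^ (5 * n) : ℂ⟦X⟧) = 1 - X ^ (5 * n) := by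
      intro k
      rw [mul_pow, ← pow_mul, show k * (5 * n) = 5 * (k * n) by ring, pow_mul, hC, one_pow, one_mul]
    simp [hk]
  · have hz := congrArg (C (R := ℂ)) (geom_sum_zeta_pow h)
    simp only [map_add, map_pow, map_one, map_zero] at hz
    have hp := prod_conjugates hz 1 (X ^ n) 0
    have hk : ∀ k, (1 - (C zeta ^ k * X) ^ n : ℂ⟦X⟧)
        = 1 - (C zeta ^ n) ^ k * X ^ n - ((C zeta ^ n) ^ k) ^ 2 * 0 := by
      intro k
      ring
    simp only [hk]
    rw [hp]
    ring

theorem prod_conj_E_one_mul :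
    (∏ k ∈ Finset.range 5, conj k (E 1)) * conj 0 (E 25) = conj 0 (E 5) ^ 6 := by
  have h1 := hasProd_prod (s := Finset.range 5) fun k _ => hasProd_conj_E k (le_refl 1)
  simp only [one_mul, prod_one_sub_conj] at h1
  have h2 := h1.mul (hasProd_conj_zero_E_five_mul (j := 5) (by norm_num))
  have h3 := hasProd_conj_E 0 (show 1 ≤ 5 by norm_num)
  have h4 := h3.mul (hasProd_prod (s := Finset.range 5) fun _ _ =>
    hasProd_conj_zero_E_five_mul (le_refl 1))
  rw [Finset.prod_const, Finset.card_range, ← pow_succ'] at h4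
  refine h2.unique ?_
  convert h4 using 2 with n
  simp only [Finset.prod_const, Finset.card_range, pow_zero, one_mul]
  split_ifs <;> ring

/-- The product of the conjugates of `E 1`, as a power series in `q ^ 5`. -/
noncomputable def norm : ℤ⟦X⟧ :=
  sect 0 (E 1) ^ 5 - 11 * X * E 5 ^ 5 + X ^ 2 * sect 2 (E 1) ^ 5

/-- After `q ↦ q ^ 5`, `norm` is the product of the conjugates of the dissection, evaluated with `a
c' = w ^ 2` where `c' = -q ^ 2 c`. -/
theorem norm_mul_E_five : norm * E 5 = E 1 ^ 6 := by
  apply dil_injective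
  apply conj_zero_injective
  have h := prod_conj_E_one_mul
  have hz := congrArg (C (R := ℂ)) (geom_sum_zeta_pow (n := 1) (by norm_num))
  simp only [map_add, map_pow, map_one, map_zero, pow_one] at hz
  have hrel := congrArg (conj 0 ∘ dil) dissection_relation
  simp only [Function.comp_apply, map_mul, map_neg, map_pow] at hrel
  set a := conj 0 (dil (sect 0 (E 1))) with ha
  set b := conj 0 (dil (E 5)) with hb
  set c := conj 0 (dil (sect 2 (E 1))) with hc
  have hk : ∀ k, conj k (E 1) = a - C zeta ^ k * (X * b) - (C zeta ^ k) ^ 2 * -(X ^ 2 * c) := by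
    intro k
    rw [E_one_eq]
    simp only [map_add, map_sub, map_mul, map_pow, conj_X]
    rw [conj_dil k, conj_dil k, conj_dil k, ← ha, ← hb, ← hc]
    ring
  simp only [hk] at h
  rw [prod_conjugates_of_mul_eq hz (by linear_combination -X ^ 2 * hrel)] at h
  rw [norm]
  simp only [map_add, map_sub, map_mul, map_pow, map_ofNat, dil_X, conj_X, pow_zero, one_mul]
  rw [← ha, ← hb, ← hc, dil_E le_rfl, mul_one, ← h,
    show E 25 = dil (E 5) from (dil_E (j := 5) (by norm_num)).symm, ← hb]
  ring

/-! ### The modular equation -/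

/-- The series `q E_25 / E_1`. -/
noncomputable def xi : ℤ⟦X⟧ := X * dil (E 5) * invE 1

/-- The series `q E_5 ^ 6 / E_1 ^ 6`. -/
noncomputable def tau : ℤ⟦X⟧ := X * E 5 ^ 6 * invE 1 ^ 6

theorem E_one_mul_xi : E 1 * xi = X * dil (E 5) := by
  rw [xi]
  linear_combination X * dil (E 5) * E_mul_invE le_rfl

theorem norm_mul_E_five_mul_invE : norm * (E 5 * invE 1 ^ 6) = 1 := by
  rw [← mul_assoc, norm_mul_E_five, ← mul_pow, E_mul_invE le_rfl, one_pow]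

theorem norm_ne_zero : norm ≠ 0 := left_ne_zero_of_mul_eq_one norm_mul_E_five_mul_invE

theorem norm_mul_tau : norm * tau = X * E 5 ^ 5 := by
  rw [tau]
  linear_combination X * E 5 ^ 5 * norm_mul_E_five_mul_invE

theorem dil_norm_mul_dil_tau : dil norm * dil tau = (X * dil (E 5)) ^ 5 := by
  rw [← map_mul, norm_mul_tau, map_mul, map_pow, dil_X, mul_pow]

theorem dil_dissection_relation :
    dil (sect 0 (E 1)) * dil (sect 2 (E 1)) = -dil (E 5) ^ 2 := by
  rw [← map_mul, dissection_relation, map_neg, map_pow]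

/-- With `c' = -q ^ 2 c` one has `a - c' = E_1 + w` and `a c' = w ^ 2`, so `a ^ 5 - c' ^ 5` is a
polynomial in `E_1` and `w`. Its `w ^ 5` coefficient is `11`, cancelled by `-11 w ^ 5`; hence `E_1`
divides the result. -/
theorem dil_norm :
    dil norm = E 1 ^ 5 + 5 * E 1 ^ 4 * (X * dil (E 5)) + 15 * E 1 ^ 3 * (X * dil (E 5)) ^ 2
      + 25 * E 1 ^ 2 * (X * dil (E 5)) ^ 3 + 25 * E 1 * (X * dil (E 5)) ^ 4 := by
  have hrel := dil_dissection_relation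
  have he := E_one_eq
  have hn : dil norm = dil (sect 0 (E 1)) ^ 5 - 11 * X ^ 5 * dil (E 5) ^ 5
      + (X ^ 5) ^ 2 * dil (sect 2 (E 1)) ^ 5 := by
    rw [norm]
    simp only [map_add, map_sub, map_mul, map_pow, map_ofNat, dil_X]
  rw [hn]
  generalize dil (sect 0 (E 1)) = a at hrel he ⊢
  generalize dil (sect 2 (E 1)) = c at hrel he ⊢
  generalize dil (E 5) = b at hrel he ⊢
  rw [he]
  have hrel' : a * -(X ^ 2 * c) = (X * b) ^ 2 := by linear_combination -X ^ 2 * hrel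
  have h : a - X * b + X ^ 2 * c = a - X * b - -(X ^ 2 * c) := by ring
  have h2 : a ^ 5 - 11 * X ^ 5 * b ^ 5 + (X ^ 5) ^ 2 * c ^ 5
      = a ^ 5 - 11 * (X * b) ^ 5 - (-(X ^ 2 * c)) ^ 5 := by ring
  rw [h, h2]
  generalize -(X ^ 2 * c) = c at hrel' ⊢
  generalize X * b = w at hrel' ⊢
  linear_combination (5 * a * w ^ 2 - 5 * c * w ^ 2 + 5 * a ^ 3 - 10 * a ^ 2 * c + 10 * a * c ^ 2
    - 5 * c ^ 3) * hrel'

theorem dil_norm_mul_xi_pow (i : ℕ) :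
    dil norm * xi ^ (i + 5) = (X * dil (E 5)) ^ 5 *
      (25 * xi ^ (i + 4) + 25 * xi ^ (i + 3) + 15 * xi ^ (i + 2) + 5 * xi ^ (i + 1) + xi ^ i) := by
  rw [dil_norm, ← E_one_mul_xi]
  ring

theorem xi_pow_add_five (i : ℕ) :
    xi ^ (i + 5) = dil tau *
      (25 * xi ^ (i + 4) + 25 * xi ^ (i + 3) + 15 * xi ^ (i + 2) + 5 * xi ^ (i + 1) + xi ^ i) := by
  have h0 : dil norm ≠ 0 := fun h => norm_ne_zero (dil_injective (by rw [h, map_zero]))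
  refine mul_left_cancel₀ h0 ?_
  rw [dil_norm_mul_xi_pow, ← mul_assoc, dil_norm_mul_dil_tau]

theorem sect_natCast_mul (r k : ℕ) (f : ℤ⟦X⟧) : sect r (k * f) = k * sect r f := by
  rw [← nsmul_eq_mul, map_nsmul, nsmul_eq_mul]

theorem sect_ofNat_mul (r k : ℕ) [k.AtLeastTwo] (f : ℤ⟦X⟧) :
    sect r (ofNat(k) * f) = ofNat(k) * sect r f := sect_natCast_mul r k f

theorem sect_xi_pow_add_five (i : ℕ) :
    sect 0 (xi ^ (i + 5)) = tau *
      (25 * sect 0 (xi ^ (i + 4)) + 25 * sect 0 (xi ^ (i + 3)) + 15 * sect 0 (xi ^ (i + 2))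
        + 5 * sect 0 (xi ^ (i + 1)) + sect 0 (xi ^ i)) := by
  rw [xi_pow_add_five, sect_dil_mul _ _ _ (by norm_num)]
  simp only [map_add, sect_ofNat_mul]

/-! ### The initial values -/

theorem X_mul_dil_E_five_pow : (X * dil (E 5)) ^ 5 = dil (X * E 5 ^ 5) := by
  rw [map_mul, map_pow, dil_X, mul_pow]

theorem sect_zero_pow_five_mul (f : ℤ⟦X⟧) :
    sect 0 ((X * dil (E 5)) ^ 5 * f) = X * E 5 ^ 5 * sect 0 f := by
  rw [X_mul_dil_E_five_pow, sect_dil_mul _ _ _ (by norm_num)]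

theorem sect_zero_pow_five : sect 0 ((X * dil (E 5)) ^ 5) = X * E 5 ^ 5 := by
  rw [X_mul_dil_E_five_pow, sect_zero_dil]

theorem sect_zero_pow_four_mul : sect 0 ((X * dil (E 5)) ^ 4 * E 1) = -(X * E 5 ^ 5) := by
  have he := E_one_eq
  set a := sect 0 (E 1)
  set c := sect 2 (E 1)
  set b := E 5
  -- The vector lists the five residue components of the expanded product, as in the next three
  -- lemmas, where the relation between `a`, `b`, `c` also simplifies the component of residue `0`.
  refine sect_of_eq 0 ![-(X * b ^ 5), X * b ^ 4 * c, 0, 0, a * b ^ 4] ?_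
  rw [he]
  simp only [Matrix.cons_val, map_neg, map_mul, map_pow, map_zero, dil_X]
  ring

theorem sect_zero_pow_three_mul : sect 0 ((X * dil (E 5)) ^ 3 * E 1 ^ 2) = -(X * E 5 ^ 5) := by
  have he := E_one_eq
  have hrel := dil_dissection_relation
  set a := sect 0 (E 1)
  set c := sect 2 (E 1)
  set b := E 5
  refine sect_of_eq 0 ![-(X * b ^ 5), -2 * X * b ^ 4 * c, X * b ^ 3 * c ^ 2, a ^ 2 * b ^ 3,
    -2 * a * b ^ 4] ?_
  rw [he]
  simp only [Matrix.cons_val, map_neg, map_mul, map_pow, map_ofNat, dil_X]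
  linear_combination 2 * X ^ 5 * dil b ^ 3 * hrel

theorem sect_zero_pow_two_mul : sect 0 ((X * dil (E 5)) ^ 2 * E 1 ^ 3) = 5 * (X * E 5 ^ 5) := by
  have he := E_one_eq
  have hrel := dil_dissection_relation
  set a := sect 0 (E 1)
  set c := sect 2 (E 1)
  set b := E 5
  refine sect_of_eq 0 ![5 * (X * b ^ 5), 3 * X * b ^ 4 * c + 3 * X * a * b ^ 2 * c ^ 2,
    -3 * X * b ^ 3 * c ^ 2 + a ^ 3 * b ^ 2, X * b ^ 2 * c ^ 3 - 3 * a ^ 2 * b ^ 3,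
    3 * a * b ^ 4 + 3 * a ^ 2 * b ^ 2 * c] ?_
  rw [he]
  simp only [Matrix.cons_val, map_add, map_sub, map_neg, map_mul, map_pow, map_ofNat, dil_X]
  linear_combination -6 * X ^ 5 * dil b ^ 3 * hrel

theorem sect_zero_mul_pow_four : sect 0 (X * dil (E 5) * E 1 ^ 4) = -5 * (X * E 5 ^ 5) := by
  have he := E_one_eq
  have hrel := dil_dissection_relation
  set a := sect 0 (E 1)
  set c := sect 2 (E 1)
  set b := E 5
  refine sect_of_eq 0 ![-5 * (X * b ^ 5),
    -4 * X * b ^ 4 * c - 12 * X * a * b ^ 2 * c ^ 2 + a ^ 4 * b,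
    6 * X * b ^ 3 * c ^ 2 + 4 * X * a * b * c ^ 3 - 4 * a ^ 3 * b ^ 2,
    -4 * X * b ^ 2 * c ^ 3 + 6 * a ^ 2 * b ^ 3 + 4 * a ^ 3 * b * c,
    X * b * c ^ 4 - 4 * a * b ^ 4 - 12 * a ^ 2 * b ^ 2 * c] ?_
  rw [he]
  simp only [Matrix.cons_val, map_add, map_sub, map_neg, map_mul, map_pow, map_ofNat, dil_X]
  linear_combination (12 * X ^ 5 * dil b ^ 3
    + 6 * X ^ 5 * dil b * (dil a * dil c - dil b ^ 2)) * hrel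

/-- Multiplication by `dil norm` clears the denominator `E_1` and commutes with extraction. The
constant is `-5 + 5 * 5 - 15 - 25 + 25`; the next three lemmas work the same way. -/
theorem sect_xi_one : sect 0 xi = 5 * tau := by
  refine mul_left_cancel₀ norm_ne_zero ?_
  have h : dil norm * xi = X * dil (E 5) * E 1 ^ 4 + 5 * ((X * dil (E 5)) ^ 2 * E 1 ^ 3)
      + 15 * ((X * dil (E 5)) ^ 3 * E 1 ^ 2) + 25 * ((X * dil (E 5)) ^ 4 * E 1)
      + 25 * (X * dil (E 5)) ^ 5 := by
    rw [dil_norm, ← E_one_mul_xi]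
    ring
  rw [← sect_dil_mul _ _ _ (by norm_num), h]
  simp only [map_add, sect_ofNat_mul, sect_zero_mul_pow_four, sect_zero_pow_two_mul,
    sect_zero_pow_three_mul, sect_zero_pow_four_mul, sect_zero_pow_five]
  linear_combination -5 * norm_mul_tau

theorem sect_xi_two : sect 0 (xi ^ 2) = tau * (10 + 25 * sect 0 xi) := by
  refine mul_left_cancel₀ norm_ne_zero ?_
  have h : dil norm * xi ^ 2 = (X * dil (E 5)) ^ 2 * E 1 ^ 3
      + 5 * ((X * dil (E 5)) ^ 3 * E 1 ^ 2) + 15 * ((X * dil (E 5)) ^ 4 * E 1)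
      + 25 * (X * dil (E 5)) ^ 5 + 25 * ((X * dil (E 5)) ^ 5 * xi) := by
    rw [dil_norm, ← E_one_mul_xi]
    ring
  rw [← sect_dil_mul _ _ _ (by norm_num), h]
  simp only [map_add, sect_ofNat_mul, sect_zero_pow_two_mul, sect_zero_pow_five_mul,
    sect_zero_pow_three_mul, sect_zero_pow_four_mul, sect_zero_pow_five]
  linear_combination -(10 + 25 * sect 0 xi) * norm_mul_tau

theorem sect_xi_three :
    sect 0 (xi ^ 3) = tau * (9 + 25 * sect 0 xi + 25 * sect 0 (xi ^ 2)) := by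
  refine mul_left_cancel₀ norm_ne_zero ?_
  have h : dil norm * xi ^ 3 = (X * dil (E 5)) ^ 3 * E 1 ^ 2
      + 5 * ((X * dil (E 5)) ^ 4 * E 1) + 15 * (X * dil (E 5)) ^ 5
      + 25 * ((X * dil (E 5)) ^ 5 * xi) + 25 * ((X * dil (E 5)) ^ 5 * xi ^ 2) := by
    rw [dil_norm, ← E_one_mul_xi]
    ring
  rw [← sect_dil_mul _ _ _ (by norm_num), h]
  simp only [map_add, sect_ofNat_mul, sect_zero_pow_five_mul,
    sect_zero_pow_three_mul, sect_zero_pow_four_mul, sect_zero_pow_five]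
  linear_combination -(9 + 25 * sect 0 xi + 25 * sect 0 (xi ^ 2)) * norm_mul_tau

theorem sect_xi_four :
    sect 0 (xi ^ 4)
      = tau * (4 + 15 * sect 0 xi + 25 * sect 0 (xi ^ 2) + 25 * sect 0 (xi ^ 3)) := by
  refine mul_left_cancel₀ norm_ne_zero ?_
  have h : dil norm * xi ^ 4 = (X * dil (E 5)) ^ 4 * E 1
      + 5 * (X * dil (E 5)) ^ 5 + 15 * ((X * dil (E 5)) ^ 5 * xi)
      + 25 * ((X * dil (E 5)) ^ 5 * xi ^ 2) + 25 * ((X * dil (E 5)) ^ 5 * xi ^ 3) := by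
    rw [dil_norm, ← E_one_mul_xi]
    ring
  rw [← sect_dil_mul _ _ _ (by norm_num), h]
  simp only [map_add, sect_ofNat_mul, sect_zero_pow_five_mul,
    sect_zero_pow_four_mul, sect_zero_pow_five]
  linear_combination -(4 + 15 * sect 0 xi + 25 * sect 0 (xi ^ 2) + 25 * sect 0 (xi ^ 3))
    * norm_mul_tau

theorem sect_zero_one : sect 0 (1 : ℤ⟦X⟧) = 1 := by
  simpa using sect_zero_dil 1

/-! ### The matrix `m` -/

theorem m_zero_right (i : ℕ) : m i 0 = 0 := by
  rw [m]

theorem m_eq_zero_of_lt {i j : ℕ} (h : i < j) : m i j = 0 := by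
  induction i using Nat.strong_induction_on generalizing j with
  | _ i ih =>
    obtain ⟨j, rfl⟩ := Nat.exists_eq_add_one_of_ne_zero (by omega : j ≠ 0)
    rcases Nat.lt_or_ge i 6 with hi | hi
    · interval_cases i
      all_goals
        rw [m, mInit] <;> intros <;> omega
    · obtain ⟨i, rfl⟩ := Nat.exists_eq_add_of_le' hi
      obtain ⟨j, rfl⟩ := Nat.exists_eq_add_one_of_ne_zero (by omega : j ≠ 0)
      simp only [m]
      rw [ih (i + 5) (by omega) (by omega), ih (i + 4) (by omega) (by omega),
        ih (i + 3) (by omega) (by omega), ih (i + 2) (by omega) (by omega),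
        ih (i + 1) (by omega) (by omega)]

/-- The part of `xi ^ i` with exponents divisible by `5` is `∑ j, m(i, j) tau(q ^ 5) ^ j`. -/
theorem sect_xi_pow (i : ℕ) (hi : 1 ≤ i) (K : ℕ) (hK : i < K) :
    sect 0 (xi ^ i) = ∑ j ∈ Finset.range K, (m i j : ℤ⟦X⟧) * tau ^ j := by
  have hred : ∑ j ∈ Finset.range K, (m i j : ℤ⟦X⟧) * tau ^ j
      = ∑ j ∈ Finset.range (i + 1), (m i j : ℤ⟦X⟧) * tau ^ j := by
    refine (Finset.sum_subset (Finset.range_mono hK) fun j _ hj => ?_).symm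
    rw [Finset.mem_range, not_lt] at hj
    rw [m_eq_zero_of_lt (by omega), Nat.cast_zero, zero_mul]
  rw [hred]
  clear hred hK K
  induction i using Nat.strong_induction_on with
  | _ i ih =>
    rcases Nat.lt_or_ge i 6 with h6 | h6
    · have h5 := sect_xi_pow_add_five 0
      simp only [zero_add, pow_zero, pow_one, sect_zero_one] at h5
      interval_cases i
      all_goals
        simp only [Finset.sum_range_succ, Finset.sum_range_zero, m, mInit, pow_one, h5,
          sect_xi_four, sect_xi_three, sect_xi_two, sect_xi_one]
        push_cast
        ring
    · obtain ⟨i, rfl⟩ := Nat.exists_eq_add_of_le' h6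
      have hr : ∀ l, l ≤ 4 → sect 0 (xi ^ (i + l + 1))
          = ∑ j ∈ Finset.range (i + 6), (m (i + l + 1) j : ℤ⟦X⟧) * tau ^ j := by
        intro l hl
        rw [ih (i + l + 1) (by omega) (by omega)]
        refine Finset.sum_subset (Finset.range_mono (by omega)) fun j _ hj => ?_
        rw [Finset.mem_range, not_lt] at hj
        rw [m_eq_zero_of_lt (by omega), Nat.cast_zero, zero_mul]
      have hm : ∀ j, (m (i + 6) (j + 1) : ℤ⟦X⟧) = 25 * m (i + 5) j + 25 * m (i + 4) j
          + 15 * m (i + 3) j + 5 * m (i + 2) j + m (i + 1) j := by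
        intro j
        cases j with
        | zero => simp [m]
        | succ j => rw [m]; push_cast; ring
      rw [Finset.sum_range_succ', m_zero_right, Nat.cast_zero, zero_mul, add_zero]
      rw [show i + 6 = i + 1 + 5 by ring, sect_xi_pow_add_five,
        show i + 1 + 4 = i + 4 + 1 by ring, show i + 1 + 3 = i + 3 + 1 by ring,
        show i + 1 + 2 = i + 2 + 1 by ring, hr 4 (by norm_num), hr 3 (by norm_num),
        hr 2 (by norm_num), hr 1 (by norm_num), show i + 1 = i + 0 + 1 by ring, hr 0 (by norm_num)]
      simp only [Finset.mul_sum, ← Finset.sum_add_distrib]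
      refine Finset.sum_congr (by rfl) fun j _ => ?_
      have := hm j
      simp only [add_assoc, Nat.reduceAdd] at this ⊢
      rw [this]
      ring

/-! ### The generating functions along the progressions -/

/-- The series under `sect 0` is `xi ^ (6 p)` divided by `E_25 ^ (6 p)`. As `m (6 p) j = 0` for `j ≤
p`, a factor `tau ^ (p + 1)` comes out. -/
theorem sect_zero_X_pow_mul_invE_pow (p : ℕ) (hp : 1 ≤ p) (K : ℕ) (hK : 5 * p ≤ K) :
    sect 0 (X ^ (6 * p) * invE 1 ^ (6 * p)) = X ^ (p + 1) * invE 1 ^ (6 * (p - 1)) *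
      ∑ k ∈ Finset.range K, (m (6 * p) (k + 1 + p) : ℤ⟦X⟧) * X ^ k * E 5 ^ (6 * (k + 1))
        * invE 1 ^ (6 * (k + 1) + 6) := by
  have h5 : E 5 ^ (6 * p) ≠ 0 :=
    left_ne_zero_of_mul_eq_one (b := invE 5 ^ (6 * p))
      (by rw [← mul_pow, E_mul_invE (by norm_num), one_pow])
  refine mul_left_cancel₀ h5 ?_
  have hxi : dil (E 5 ^ (6 * p)) * (X ^ (6 * p) * invE 1 ^ (6 * p)) = xi ^ (6 * p) := by
    rw [map_pow, xi]
    ring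
  rw [← sect_dil_mul _ _ _ (by norm_num), hxi,
    sect_xi_pow _ (by omega) (p + 1 + K) (by omega), Finset.sum_range_add,
    Finset.sum_eq_zero (s := Finset.range (p + 1)) fun j hj => by
      rw [m_eq_zero j _ (by have := Finset.mem_range.1 hj; omega), Nat.cast_zero, zero_mul],
    zero_add, Finset.mul_sum, Finset.mul_sum]
  refine Finset.sum_congr rfl fun k _ => ?_
  obtain ⟨p, rfl⟩ := Nat.exists_eq_add_of_le' hp
  rw [tau, show p + 1 + 1 + k = k + 1 + (p + 1) by ring, Nat.add_sub_cancel]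
  ring

/-- Case `p = 1`: multiplying by `q ^ 6` moves residue `4` to residue `0`. -/
theorem sect_four_invE_pow (K : ℕ) (hK : 5 ≤ K) :
    sect 4 (invE 1 ^ 6) = ∑ k ∈ Finset.range K, (m 6 (k + 1 + 1) : ℤ⟦X⟧) * X ^ k
      * E 5 ^ (6 * (k + 1)) * invE 1 ^ (6 * (k + 1) + 6) := by
  refine mul_left_cancel₀ (pow_ne_zero 2 (X_ne_zero (R := ℤ))) ?_
  have h := sect_zero_X_pow_mul_invE_pow 1 le_rfl K hK
  have h2 := sect_zero_X_pow_mul 1 (by norm_num) (by norm_num) (invE 1 ^ 6)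
  norm_num at h h2
  rw [← h2, h]

theorem sect_three_term (l K : ℕ) (hK : 5 * l + 10 ≤ K) :
    sect 3 (X ^ l * E 5 ^ (6 * (l + 1)) * invE 1 ^ (6 * (l + 1) + 6))
      = ∑ k ∈ Finset.range K, (m (6 * (l + 1) + 6) (k + 1 + (l + 1) + 1) : ℤ⟦X⟧) * X ^ k
        * E 5 ^ (6 * (k + 1)) * invE 1 ^ (6 * (k + 1) + 6) := by
  refine mul_left_cancel₀ (pow_ne_zero (l + 3) (X_ne_zero (R := ℤ))) ?_
  have h := sect_zero_X_pow_mul_invE_pow (l + 2) (by omega) K (by omega)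
  have h2 := sect_zero_X_pow_mul 2 (by norm_num) (by norm_num)
    (X ^ l * E 5 ^ (6 * (l + 1)) * invE 1 ^ (6 * (l + 1) + 6))
  -- The shift by `q ^ 7` moves residue `3` to `0`; a further `q ^ (5 (l + 1))` completes the
  -- exponent `6 (l + 2)`, while the powers of `E 5` are series in `q ^ 5` and leave the extraction.
  have h3 : dil (X ^ (l + 1)) * (X ^ (5 + 2) *
      (X ^ l * E 5 ^ (6 * (l + 1)) * invE 1 ^ (6 * (l + 1) + 6)))
      = dil (E 1 ^ (6 * (l + 1))) * (X ^ (6 * (l + 2)) * invE 1 ^ (6 * (l + 2))) := by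
    rw [map_pow, map_pow, dil_X, dil_E le_rfl]
    ring
  have h4 := congrArg (sect 0) h3
  rw [sect_dil_mul _ _ _ (by norm_num), sect_dil_mul _ _ _ (by norm_num), h, h2] at h4
  have h5 : E 1 ^ (6 * (l + 1)) * invE 1 ^ (6 * (l + 1)) = 1 := by
    rw [← mul_pow, E_mul_invE le_rfl, one_pow]
  have h6 : 6 * (l + 2) = 6 * (l + 1) + 6 := by ring
  have h7 : ∀ k, k + 1 + (l + 2) = k + 1 + (l + 1) + 1 := fun k => by ring
  rw [show l + 2 - 1 = l + 1 by omega] at h4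
  simp only [h6, h7] at h4
  norm_num at h4
  set S := ∑ k ∈ Finset.range K, (m (6 * (l + 1) + 6) (k + 1 + (l + 1) + 1) : ℤ⟦X⟧) * X ^ k
        * E 5 ^ (6 * (k + 1)) * invE 1 ^ (6 * (k + 1) + 6)
  linear_combination h4 + X ^ (l + 3) * S * h5

/-! ### The array `b` -/

theorem b_succ (j k L : ℕ) (hj : 1 ≤ j) (hL : ∀ i, L < i → b j i = 0) :
    b (j + 1) k = ∑ i ∈ Finset.range L, b j (i + 1) * m (6 * (i + 1) + 6) (k + (i + 1) + 1) := by
  obtain ⟨j, rfl⟩ := Nat.exists_eq_add_of_le' hj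
  rw [b]
  refine (finsum_mem_eq_sum_of_inter_support_eq (s := {i : ℕ | 1 ≤ i})
    (t := (Finset.range L).map (addRightEmbedding 1)) _ ?_).trans (Finset.sum_map _ _ _)
  ext i
  simp only [Set.mem_inter_iff, Set.mem_ofPred_eq, Finset.coe_map, Set.mem_image, Finset.mem_coe,
    Finset.mem_range, addRightEmbedding_apply, Function.mem_support]
  refine and_congr_left fun hi => ⟨fun h1 => ⟨i - 1, ?_, by omega⟩, ?_⟩
  · by_contra hlt
    exact hi (by rw [hL i (by omega), zero_mul])
  · rintro ⟨n, -, rfl⟩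
    omega

theorem b_one (k : ℕ) : b 1 (k + 1) = m 6 (k + 1 + 1) := by
  rw [b]
  match k with
  | 0 | 1 | 2 | 3 | 4 => simp [bInit, m, mInit]
  | k + 5 =>
    rw [m_eq_zero_of_lt (by omega), bInit] <;> intros <;> omega

/-- The bound `L` on the support of the row is carried through the induction so that all sums stay
finite and can be interchanged. -/
theorem exists_mk_numColored_eq_sum (j : ℕ) (hj : 1 ≤ j) : ∃ L, (∀ i, L < i → b j i = 0) ∧
    (mk fun n => (numColored 6 (5 ^ j * n + (3 * 5 ^ j + 1) / 4) : ℤ))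
      = ∑ l ∈ Finset.range L, (b j (l + 1) : ℤ⟦X⟧) * X ^ l * E 5 ^ (6 * (l + 1))
        * invE 1 ^ (6 * (l + 1) + 6) := by
  induction j, hj using Nat.le_induction with
  | base =>
    refine ⟨5, fun i hi => ?_, ?_⟩
    · obtain ⟨i, rfl⟩ := Nat.exists_eq_add_one_of_ne_zero (by omega : i ≠ 0)
      rw [b_one, m_eq_zero_of_lt (by omega)]
    · simp only [b_one]
      rw [← sect_four_invE_pow 5 le_rfl, ← mk_numColored_eq_invE_pow]
      ext n
      simp
  | succ j hj ih =>
    obtain ⟨L, hL, h⟩ := ih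
    refine ⟨5 * L + 10, fun k hk => ?_, ?_⟩
    · rw [b_succ j k L hj hL]
      refine Finset.sum_eq_zero fun i hi => ?_
      have := Finset.mem_range.1 hi
      rw [m_eq_zero_of_lt (by omega), mul_zero]
    · have hsect : (mk fun n => (numColored 6 (5 ^ (j + 1) * n + (3 * 5 ^ (j + 1) + 1) / 4) : ℤ))
          = sect 3 (mk fun n => (numColored 6 (5 ^ j * n + (3 * 5 ^ j + 1) / 4) : ℤ)) := by
        ext n
        rw [coeff_sect, coeff_mk, coeff_mk]
        congr 2
        rw [pow_succ, mul_add]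
        -- The next progression is the class of `3` mod `5` inside the current one, because `15 x +
        -- 1 = 4 * (3 x) + (3 x + 1)` for `x = 5 ^ j`.
        have h1 : (3 * (5 ^ j * 5) + 1) / 4 = 5 ^ j * 3 + (3 * 5 ^ j + 1) / 4 := by omega
        rw [h1]
        ring
      have hterm : ∀ l ∈ Finset.range L, sect 3 ((b j (l + 1) : ℤ⟦X⟧) * X ^ l
          * E 5 ^ (6 * (l + 1)) * invE 1 ^ (6 * (l + 1) + 6))
          = ∑ k ∈ Finset.range (5 * L + 10), (b j (l + 1) : ℤ⟦X⟧)
            * ((m (6 * (l + 1) + 6) (k + 1 + (l + 1) + 1) : ℤ⟦X⟧) * X ^ k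
              * E 5 ^ (6 * (k + 1)) * invE 1 ^ (6 * (k + 1) + 6)) := by
        intro l hl
        have := Finset.mem_range.1 hl
        rw [mul_assoc, mul_assoc, sect_natCast_mul, ← mul_assoc (X ^ l),
          sect_three_term l (5 * L + 10) (by omega), Finset.mul_sum]
      rw [hsect, h, map_sum, Finset.sum_congr rfl hterm, Finset.sum_comm]
      refine Finset.sum_congr rfl fun k _ => ?_
      rw [b_succ j (k + 1) L hj hL, Nat.cast_sum, Finset.sum_mul, Finset.sum_mul, Finset.sum_mul]
      refine Finset.sum_congr rfl fun l _ => ?_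
      push_cast
      ring

end ColoredPartitions

theorem theorem4p4 (j : ℕ) (hj : 1 ≤ j) :
    HasSum
      (fun r : ℕ =>
        (ColoredPartitions.b j (r + 1) : PowerSeries ℤ) * PowerSeries.X ^ r
          * ColoredPartitions.E 5 ^ (6 * (r + 1))
          * ColoredPartitions.invE 1 ^ (6 * (r + 1) + 6))
      (PowerSeries.mk fun n : ℕ =>
        (ColoredPartitions.numColored 6 (5 ^ j * n + (3 * 5 ^ j + 1) / 4) : ℤ)) := by
  obtain ⟨L, hL, h⟩ := ColoredPartitions.exists_mk_numColored_eq_sum j hj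
  rw [h]
  refine hasSum_sum_of_ne_finset_zero fun r hr => ?_
  rw [Finset.mem_range, not_lt] at hr
  rw [hL _ (by omega)]
  simp
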